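/- Conventions. For a commutative ring $A$, a point $\alpha$ of the real spectrum $\mathrm{Spec}_r A$ is a pair $(\mathfrak p,\le_\alpha)$ with $\mathfrak p=\mathrm{supp}(\alpha)$ a prime ideal and $\le_\alpha$ an ordering of the fraction field of $A/\mathfrak p$; the topology of $\mathrm{Spec}_r A$ is generated by the sets $\{\alpha : a>_\alpha 0\}$, $a\in A$, and $\beta$ is a generization of $\alpha$ if $\alpha\in\overline{\{\beta\}}$. An element $a$ changes sign on $\mathrm{Spec}_r A$ if $a>_\alpha0$ and $a<_\beta0$ for some $\alpha,\beta\in\mathrm{Spec}_r A$. An irreducible $p\in A$ is called real if $-1$ is not a sum of squares in $A/(p)$, and non-real otherwise. A symmetric matrix $M$ over $A$ is positive semidefinite on $\mathrm{Spec}_r A$ if $\varphi(M)$ is positive semidefinite for every ring homomorphism $\varphi:A\to R$ into a real closed field $R$. Consider the conditions: (PNRI) Every non-real irreducible of $A$ is associated to a non-real irreducible $q'$ with $q'>_\alpha0$ for all $\alpha\in\mathrm{Spec}_r A$. (GRI) with respect to a real irreducible $p$: there are $\alpha,\beta\in\mathrm{Spec}_r A$ with $\mathrm{supp}(\alpha)=(p)$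 and $\mathrm{supp}(\beta)=(0)$ such that $\beta$ is a generization of $\alpha$. Theorem. Let $A$ be a regular unique factorization domain and let $M\in A^{n\times n}$ be a symmetric matrix that is positive semidefinite on $\mathrm{Spec}_r A$. Assume that $M$ admits a Smith normal form, i.e. there are $r\le n$, elements $d_1\mid d_2\mid\cdots\mid d_r$ of $A$ and matrices $P,Q\in A^{n\times n}$ whose determinants are units such that $M=P\,\mathrm{diag}(d_1,\dots,d_r,0,\dots,0)\,Q$. Assume furthermore that $A$ satisfies (PNRI), and that (GRI) holds with respect to every real irreducible $p$ that divides some $d_k$ and changes sign on $\mathrm{Spec}_r A$. Then for every $k=1,\dots,r$ the element $d_k$ is associated to an element $d'_k\in A$ that is positive on $\mathrm{Spec}_r A$ in the following sense: for all $\alpha\in\mathrm{Spec}_r A$ one has $d'_k\ge_\alpha0$, and $d'_k>_\alpha0$ whenever $d_k\notin\mathrm{supp}(\alpha)$. -/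

import Mathlib

universe u

/-- The real spectrum of a commutative ring: the set of its orderings (prime cones). A pair
`(𝔭, ≤)` of a prime ideal and an ordering of `A ⧸ 𝔭` (equivalently, of its fraction field)
corresponds to the set `P` of all `a` whose class is nonnegative, and `𝔭 = P ∩ -P`. -/
def RealSpectrum (A : Type u) [CommRing A] : Type u :=
  {P : RingPreordering A // P.IsOrdering}

namespace RealSpectrum

variable {A : Type u} [CommRing A]

instance (α : RealSpectrum A) : α.1.IsOrdering := α.2

/-- The support of a point, a prime ideal of `A`. -/
def supp (α : RealSpectrum A) : Ideal A := α.1.support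

/-- `a ≥ 0` at the point `α`. -/
def IsNonneg (α : RealSpectrum A) (a : A) : Prop := a ∈ α.1

/-- `a > 0` at the point `α`. -/
def IsPos (α : RealSpectrum A) (a : A) : Prop := a ∈ α.1 ∧ a ∉ α.supp

/-- The topology generated by the sets `{α | a > 0 at α}`, `a ∈ A`. In Mathlib's notation
`β ⤳ α` says that `α` lies in the closure of `{β}`, that is, `β` is a generization of `α`. -/
instance : TopologicalSpace (RealSpectrum A) :=
  TopologicalSpace.generateFrom {U | ∃ a : A, U = {α | α.IsPos a}}

end RealSpectrum

/-- `a` changes sign on the real spectrum: it is positive at some point, negative at another. -/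
def ChangesSign {A : Type u} [CommRing A] (a : A) : Prop :=
  ∃ α β : RealSpectrum A, α.IsPos a ∧ β.IsPos (-a)

/-- A real irreducible: `-1` is not a sum of squares in `A ⧸ (p)`
(this is Mathlib's `IsSemireal`). -/
def IsRealIrreducible {A : Type u} [CommRing A] (p : A) : Prop :=
  Irreducible p ∧ IsSemireal (A ⧸ Ideal.span {p})

/-- A non-real irreducible. -/
def IsNonRealIrreducible {A : Type u} [CommRing A] (q : A) : Prop :=
  Irreducible q ∧ ¬ IsSemireal (A ⧸ Ideal.span {q})

/-- Condition (PNRI): every non-real irreducible is associated to a non-real irreducible which is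
strictly positive on the whole real spectrum. -/
def PNRI (A : Type u) [CommRing A] : Prop :=
  ∀ q : A, IsNonRealIrreducible q →
    ∃ q' : A, Associated q q' ∧ IsNonRealIrreducible q' ∧ ∀ α : RealSpectrum A, α.IsPos q'

/-- Condition (GRI) with respect to `p`: some point with support `(p)` has a generization with
support `(0)`. -/
def GRI {A : Type u} [CommRing A] (p : A) : Prop :=
  ∃ α β : RealSpectrum A, α.supp = Ideal.span {p} ∧ β.supp = ⊥ ∧ β ⤳ α

/-- Positive semidefiniteness of a symmetric matrix on the real spectrum: its image under every
ring homomorphism into a real closed field is positive semidefinite. -/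
def IsPsdOnRealSpectrum {A : Type u} [CommRing A] {n : ℕ} (M : Matrix (Fin n) (Fin n) A) : Prop :=
  ∀ (R : Type u) [Field R] [LinearOrder R] [IsStrictOrderedRing R] [IsRealClosed R]
    (φ : A →+* R) (v : Fin n → R), 0 ≤ dotProduct v ((M.map φ).mulVec v)

/-- `M ∼ N`: `M = P N Q` for matrices `P`, `Q` whose determinants are units. -/
def MatrixEquivalent {A : Type u} [CommRing A] {n : ℕ} (M N : Matrix (Fin n) (Fin n) A) : Prop :=
  ∃ P Q : Matrix (Fin n) (Fin n) A, IsUnit P.det ∧ IsUnit Q.det ∧ M = P * N * Q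

/-- The `n × n` matrix `diag(d₁, …, d_r, 0, …, 0)`. -/
def diagZero {A : Type u} [CommRing A] (n : ℕ) {r : ℕ} (d : Fin r → A) :
    Matrix (Fin n) (Fin n) A :=
  Matrix.diagonal fun i => if h : (i : ℕ) < r then d ⟨i, h⟩ else 0

/-! The heart is a parity statement: if `(p)` is the support of a point `α`, then `p` has even order
in every `d_k`. For an irreducible `p ∣ d_k` that changes sign, (GRI) supplies such an `α`. Put `x =
Q⁻¹eₖ` and `y = P⁻ᵀeₖ`. The quadratic form of `M` takes the values `d_k s`, `d_k t` and `d_k (s + t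
+ 2)` at `x`, `y` and `x + y`; all three are nonnegative at every ordering with support zero. In the
style of Baer–Krull, `α` lifts to two such orderings, with `p` positive in one and negative in the
other (`exists_lift`). If `p` had odd order in `d_k`, comparing them would force `p` to divide each
cofactor (`dvd_of_odd_of_forall_mem`), hence `2`, which is positive at `α`. Semidefiniteness is
given over real closed fields, so each ordering with support zero is first realized in one, by an
Artin–Schreier argument (`exists_ringHom_isRealClosed`). Finally `d_k` is factored, and each prime
power is replaced by a nonnegative associate (`exists_associated_nonneg`). -/

/-! ### Real closed fields over preordered fields. -/

section RealClosure

open Polynomial IntermediateField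

/-- In a simple extension generated by a root of `f`, every element is the value of a polynomial
of degree less than that of `f`. -/
theorem exists_aeval_eq_of_mem_adjoin_root {F E : Type*} [Field F] [Field E] [Algebra F E]
    {f : F[X]} (hf : f ≠ 0) {θ : E} (hθ : aeval θ f = 0) {z : E} (hz : z ∈ F⟮θ⟯) :
    ∃ g : F[X], g.degree < f.degree ∧ z = aeval θ g := by
  have h : z ∈ F⟮θ⟯.toSubalgebra := hz
  rw [adjoin_simple_toSubalgebra_of_isAlgebraic ⟨f, hf, hθ⟩,
    Algebra.adjoin_singleton_eq_range_aeval] at h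
  obtain ⟨g, rfl⟩ := h
  refine ⟨g % f, EuclideanDomain.mod_lt g hf, ?_⟩
  conv_lhs => rw [← EuclideanDomain.div_add_mod g f]
  simp [hθ]

/-- Polynomials sharing the features of sums of squares of polynomials of degree less than `n`. -/
structure IsPsdPolynomial {F : Type*} [Field F] [LinearOrder F] (n : ℕ) (G : F[X]) : Prop where
  even_natDegree : Even G.natDegree
  natDegree_le : G.natDegree ≤ 2 * n
  leadingCoeff_nonneg : 0 ≤ G.leadingCoeff
  eval_nonneg : ∀ r, 0 ≤ G.eval r

/-- Leading coefficients of nonzero summands are positive, so they cannot cancel and the degree of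
the sum is the larger of the two. -/
theorem IsPsdPolynomial.add {F : Type*} [Field F] [LinearOrder F] [IsStrictOrderedRing F] {n : ℕ}
    {G H : F[X]} (hG : IsPsdPolynomial n G) (hH : IsPsdPolynomial n H) :
    IsPsdPolynomial n (G + H) := by
  have hev : ∀ r, 0 ≤ (G + H).eval r := fun r => by
    rw [eval_add]; exact add_nonneg (hG.eval_nonneg r) (hH.eval_nonneg r)
  rcases eq_or_ne G 0 with rfl | hG0
  · simpa using hH
  rcases eq_or_ne H 0 with rfl | hH0
  · simpa using hG
  have hGp : 0 < G.leadingCoeff :=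
    lt_of_le_of_ne hG.leadingCoeff_nonneg (leadingCoeff_ne_zero.2 hG0).symm
  have hHp : 0 < H.leadingCoeff :=
    lt_of_le_of_ne hH.leadingCoeff_nonneg (leadingCoeff_ne_zero.2 hH0).symm
  rcases lt_trichotomy G.degree H.degree with h | h | h
  · have hd := natDegree_eq_of_degree_eq (degree_add_eq_right_of_degree_lt h)
    exact ⟨hd ▸ hH.even_natDegree, hd ▸ hH.natDegree_le,
      leadingCoeff_add_of_degree_lt h ▸ hH.leadingCoeff_nonneg, hev⟩
  · have hne : G.leadingCoeff + H.leadingCoeff ≠ 0 := (add_pos hGp hHp).ne'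
    have hd : (G + H).natDegree = G.natDegree :=
      natDegree_eq_of_degree_eq (by
        rw [degree_add_eq_of_leadingCoeff_add_ne_zero hne, h, max_self])
    exact ⟨hd ▸ hG.even_natDegree, hd ▸ hG.natDegree_le,
      leadingCoeff_add_of_degree_eq h hne ▸ (add_pos hGp hHp).le, hev⟩
  · have hd := natDegree_eq_of_degree_eq (degree_add_eq_left_of_degree_lt h)
    exact ⟨hd ▸ hG.even_natDegree, hd ▸ hG.natDegree_le,
      leadingCoeff_add_of_degree_lt' h ▸ hG.leadingCoeff_nonneg, hev⟩

theorem IsPsdPolynomial.sq {F : Type*} [Field F] [LinearOrder F] [IsStrictOrderedRing F] {n : ℕ}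
    {g : F[X]} (hg : g.natDegree ≤ n) : IsPsdPolynomial n (g ^ 2) := by
  refine ⟨?_, ?_, ?_, fun r => ?_⟩
  · rw [natDegree_pow]; exact even_two_mul _
  · rw [natDegree_pow]; omega
  · rw [leadingCoeff_pow]; positivity
  · rw [eval_pow]; positivity

/-- An ordered field none of whose proper simple algebraic extensions is formally real has a root
of every polynomial of odd degree. -/
theorem exists_isRoot_of_odd_natDegree_of_neg_one_mem {F E : Type*} [Field F] [LinearOrder F]
    [IsStrictOrderedRing F] [Field E] [Algebra F E] [IsAlgClosed E]
    (h : ∀ θ : E, θ ∉ (algebraMap F E).range →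
      (-1 : E) ∈ AddSubmonoid.closure {z | ∃ x ∈ F⟮θ⟯, z = x ^ 2})
    {f : F[X]} (hf : Odd f.natDegree) : ∃ x, f.IsRoot x := by
  induction hn : f.natDegree using Nat.strong_induction_on generalizing f with
  | h n ih =>
  subst hn
  have hf0 : f ≠ 0 := by rintro rfl; simp at hf
  have hfu : ¬ IsUnit f := fun hu => by simp [natDegree_eq_zero_of_isUnit hu] at hf
  by_cases hirr : Irreducible f
  · obtain ⟨θ, hθ⟩ := IsAlgClosed.exists_aeval_eq_zero E f
      (degree_pos_of_irreducible hirr).ne'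
    by_cases hmem : θ ∈ (algebraMap F E).range
    · obtain ⟨x, rfl⟩ := hmem
      refine ⟨x, ?_⟩
      rw [aeval_algebraMap_apply] at hθ
      simpa using hθ
    exfalso
    have key : ∀ z ∈ AddSubmonoid.closure {z : E | ∃ x ∈ F⟮θ⟯, z = x ^ 2},
        ∃ G : F[X], IsPsdPolynomial (f.natDegree - 1) G ∧ z = aeval θ G := by
      intro z hz
      induction hz using AddSubmonoid.closure_induction with
      | mem z hz =>
        obtain ⟨x, hx, rfl⟩ := hz
        obtain ⟨g, hg, rfl⟩ := exists_aeval_eq_of_mem_adjoin_root hf0 hθ hx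
        refine ⟨g ^ 2, .sq ?_, by simp⟩
        rcases eq_or_ne g 0 with rfl | hg0
        · simp
        · have := natDegree_lt_natDegree hg0 hg
          omega
      | zero => exact ⟨0, by simpa using IsPsdPolynomial.sq (g := (0 : F[X])) (by simp), by simp⟩
      | add x y _ _ hx hy =>
        obtain ⟨G, hG, rfl⟩ := hx
        obtain ⟨H, hH, rfl⟩ := hy
        exact ⟨G + H, hG.add hH, by simp⟩
    obtain ⟨G, hG, hG1⟩ := key _ (h θ hmem)
    have hG' : IsPsdPolynomial (f.natDegree - 1) (G + 1) :=
      hG.add (by simpa using IsPsdPolynomial.sq (g := (1 : F[X])) (n := f.natDegree - 1) (by simp))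
    have hpos : ∀ r, 0 < (G + 1).eval r := fun r => by
      simpa using add_pos_of_nonneg_of_pos (hG.eval_nonneg r) one_pos
    have hdvd : f ∣ G + 1 := by
      have h0 : aeval θ (G + 1) = 0 := by simp [← hG1]
      have hint : IsIntegral F θ := IsAlgebraic.isIntegral ⟨f, hf0, hθ⟩
      exact ((minpoly.irreducible hint).dvd_symm hirr (minpoly.dvd F θ hθ)).trans
        (minpoly.dvd F θ h0)
    -- `G + 1 = f * g` has even degree at most `2 (deg f - 1)`, so `g` has odd degree below `deg f`.
    -- By induction `g` has a root, where `G + 1` would vanish although `G ≥ 0`.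
    obtain ⟨g, hg⟩ := hdvd
    have hg0 : g ≠ 0 := by
      rintro rfl
      have := hpos 0
      simp [hg] at this
    have hdeg : (G + 1).natDegree = f.natDegree + g.natDegree := by
      rw [hg, natDegree_mul hf0 hg0]
    have he := hG'.even_natDegree
    have hle := hG'.natDegree_le
    rw [hdeg] at he hle
    have hgodd : Odd g.natDegree := by
      rw [Nat.even_add] at he
      rw [← Nat.not_even_iff_odd] at hf ⊢
      tauto
    have hfpos := hf.pos
    obtain ⟨x, hx⟩ := ih g.natDegree (by omega) hgodd rfl
    have := hpos x
    rw [hg, eval_mul, hx.eq_zero, mul_zero] at this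
    exact lt_irrefl _ this
  · rw [irreducible_iff] at hirr
    push Not at hirr
    obtain ⟨a, b, rfl, ha, hb⟩ := hirr hfu
    have ha0 : a ≠ 0 := left_ne_zero_of_mul hf0
    have hb0 : b ≠ 0 := right_ne_zero_of_mul hf0
    have hda : a.natDegree ≠ 0 := fun h0 => ha <| by
      rw [isUnit_iff_degree_eq_zero, degree_eq_natDegree ha0, h0]; rfl
    have hdb : b.natDegree ≠ 0 := fun h0 => hb <| by
      rw [isUnit_iff_degree_eq_zero, degree_eq_natDegree hb0, h0]; rfl
    have hdeg := natDegree_mul ha0 hb0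
    rcases Nat.even_or_odd a.natDegree with hae | hao
    · have hbo : Odd b.natDegree := by
        rw [hdeg, Nat.odd_add] at hf
        rw [← Nat.not_even_iff_odd] at hf ⊢
        tauto
      obtain ⟨x, hx⟩ := ih b.natDegree (by omega) hbo rfl
      exact ⟨x, hx.dvd (dvd_mul_left _ _)⟩
    · obtain ⟨x, hx⟩ := ih a.natDegree (by omega) hao rfl
      exact ⟨x, hx.dvd (dvd_mul_right _ _)⟩

namespace RingPreordering

variable {K : Type u} [Field K] {E : Type*} [Field E] [Algebra K E] (T : RingPreordering K)

/-- The sums `∑ tᵢ xᵢ²` with `tᵢ ∈ T` and `xᵢ` in the intermediate field `L`. -/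
def cone (L : IntermediateField K E) : AddSubmonoid E :=
  AddSubmonoid.closure {z | ∃ t ∈ T, ∃ x ∈ L, z = algebraMap K E t * x ^ 2}

variable {T}

theorem mul_sq_mem_cone {L : IntermediateField K E} {t : K} (ht : t ∈ T) {x : E} (hx : x ∈ L) :
    algebraMap K E t * x ^ 2 ∈ T.cone L :=
  AddSubmonoid.subset_closure ⟨t, ht, x, hx, rfl⟩

theorem sq_mem_cone {L : IntermediateField K E} {x : E} (hx : x ∈ L) : x ^ 2 ∈ T.cone L := by
  simpa using mul_sq_mem_cone (one_mem T) hx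

theorem algebraMap_mem_cone {L : IntermediateField K E} {t : K} (ht : t ∈ T) :
    algebraMap K E t ∈ T.cone L := by
  simpa using mul_sq_mem_cone ht (one_mem L)

theorem one_mem_cone (L : IntermediateField K E) : (1 : E) ∈ T.cone L := by
  simpa using sq_mem_cone (T := T) (one_mem L)

theorem mem_of_mem_cone {L : IntermediateField K E} {z : E} (hz : z ∈ T.cone L) : z ∈ L := by
  induction hz using AddSubmonoid.closure_induction with
  | mem z hz =>
    obtain ⟨t, -, x, hx, rfl⟩ := hz
    exact mul_mem (L.algebraMap_mem t) (pow_mem hx 2)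
  | zero => exact zero_mem L
  | add x y _ _ hx hy => exact add_mem hx hy

theorem mul_mem_cone {L : IntermediateField K E} {y z : E} (hy : y ∈ T.cone L)
    (hz : z ∈ T.cone L) : y * z ∈ T.cone L := by
  induction hy using AddSubmonoid.closure_induction with
  | mem y hy =>
    obtain ⟨t, ht, x, hx, rfl⟩ := hy
    induction hz using AddSubmonoid.closure_induction with
    | mem z hz =>
      obtain ⟨t', ht', x', hx', rfl⟩ := hz
      have := mul_sq_mem_cone (mul_mem ht ht') (mul_mem hx hx')
      rw [map_mul] at this
      convert this using 1
      ring
    | zero => simp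
    | add a b _ _ ha hb => rw [mul_add]; exact add_mem ha hb
  | zero => simp
  | add a b _ _ ha hb => rw [add_mul]; exact add_mem ha hb

theorem mem_of_mem_cone_bot {z : E} (hz : z ∈ T.cone (⊥ : IntermediateField K E)) :
    ∃ t ∈ T, z = algebraMap K E t := by
  induction hz using AddSubmonoid.closure_induction with
  | mem z hz =>
    obtain ⟨t, ht, x, hx, rfl⟩ := hz
    obtain ⟨y, rfl⟩ := IntermediateField.mem_bot.1 hx
    exact ⟨t * y ^ 2, mul_mem ht (T.pow_two_mem y), by simp⟩
  | zero => exact ⟨0, zero_mem T, by simp⟩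
  | add a b _ _ ha hb =>
    obtain ⟨s, hs, rfl⟩ := ha
    obtain ⟨t, ht, rfl⟩ := hb
    exact ⟨s + t, add_mem hs ht, by simp⟩

theorem cone_mono {L L' : IntermediateField K E} (h : L ≤ L') : T.cone L ≤ T.cone L' :=
  AddSubmonoid.closure_mono fun _ ⟨t, ht, x, hx, hz⟩ => ⟨t, ht, x, h hx, hz⟩

theorem exists_mem_cone_of_mem_cone_sSup {c : Set (IntermediateField K E)}
    (hc : IsChain (· ≤ ·) c) (hne : c.Nonempty) {z : E} (hz : z ∈ T.cone (sSup c)) :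
    ∃ L ∈ c, z ∈ T.cone L := by
  have : Nonempty c := hne.to_subtype
  induction hz using AddSubmonoid.closure_induction with
  | mem z hz =>
    obtain ⟨t, ht, x, hx, rfl⟩ := hz
    rw [sSup_eq_iSup', ← SetLike.mem_coe, coe_iSup_of_directed hc.directed, Set.mem_iUnion] at hx
    obtain ⟨L, hL⟩ := hx
    exact ⟨L, L.2, mul_sq_mem_cone ht hL⟩
  | zero => exact ⟨hne.some, hne.some_mem, zero_mem _⟩
  | add a b _ _ ha hb =>
    obtain ⟨L, hL, ha⟩ := ha
    obtain ⟨L', hL', hb⟩ := hb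
    rcases hc.total hL hL' with h | h
    · exact ⟨L', hL', add_mem (cone_mono h ha) hb⟩
    · exact ⟨L, hL, add_mem ha (cone_mono h hb)⟩

variable (T E) in
/-- There is a maximal intermediate field to which the preordering `T` extends. -/
theorem exists_maximal_neg_one_notMem_cone :
    ∃ L : IntermediateField K E, Maximal (fun L => (-1 : E) ∉ T.cone L) L := by
  obtain ⟨L, -, hL⟩ := zorn_le_nonempty₀ {L : IntermediateField K E | (-1 : E) ∉ T.cone L}
    (fun c hc hchain y hy => ⟨sSup c, fun h => by
        obtain ⟨L, hL, h⟩ := exists_mem_cone_of_mem_cone_sSup hchain ⟨y, hy⟩ h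
        exact hc hL h, fun z hz => le_sSup hz⟩) ⊥ (fun h => by
      obtain ⟨t, ht, h⟩ := mem_of_mem_cone_bot h
      have : t = -1 := (algebraMap K E).injective (by simp [← h])
      exact T.neg_one_notMem (this ▸ ht))
  exact ⟨L, hL⟩

variable {L : IntermediateField K E} (hL : Maximal (fun L => (-1 : E) ∉ T.cone L) L)

include hL in
theorem neg_one_mem_cone_adjoin {θ : E} (hθ : θ ∉ L) :
    (-1 : E) ∈ T.cone (L⟮θ⟯.restrictScalars K) := by
  by_contra h
  refine hθ (hL.le_of_ge h (fun x hx => ?_) ?_)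
  · exact (L⟮θ⟯).algebraMap_mem ⟨x, hx⟩
  · exact mem_adjoin_simple_self L θ

/-- Expand `t (u + v s)² = t u² + a t v² + 2 t u v s` and sum. -/
theorem exists_eq_of_mem_cone_adjoin_sqrt {a s z : E} (ha : a ∈ L) (hs : s ^ 2 = a)
    (hz : z ∈ T.cone (L⟮s⟯.restrictScalars K)) :
    ∃ c₁ ∈ T.cone L, ∃ c₂ ∈ T.cone L, ∃ y ∈ L, z = c₁ + a * c₂ + s * y := by
  induction hz using AddSubmonoid.closure_induction with
  | mem z hz =>
    obtain ⟨t, ht, x, hx, rfl⟩ := hz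
    have hd : (X ^ 2 - C (⟨a, ha⟩ : L)).degree = 2 := degree_X_pow_sub_C (by norm_num) _
    have hr : aeval s (X ^ 2 - C (⟨a, ha⟩ : L)) = 0 := by
      simp only [map_sub, map_pow, aeval_X, aeval_C, hs]
      exact sub_self a
    obtain ⟨g, hg, rfl⟩ := exists_aeval_eq_of_mem_adjoin_root
      (ne_zero_of_degree_gt (n := 0) (by rw [hd]; norm_num)) hr hx
    rw [hd] at hg
    have hg1 : g.degree ≤ 1 := Order.le_of_lt_succ hg
    rw [eq_X_add_C_of_degree_le_one hg1]
    refine ⟨_, mul_sq_mem_cone ht (g.coeff 0).2, _, mul_sq_mem_cone ht (g.coeff 1).2,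
      algebraMap K E t * (2 * ((g.coeff 0 : L) : E) * (g.coeff 1 : L)),
      mul_mem (L.algebraMap_mem t) (mul_mem (mul_mem (ofNat_mem L 2) (g.coeff 0).2)
        (g.coeff 1).2), ?_⟩
    simp only [map_add, map_mul, aeval_X, aeval_C, ← hs, IntermediateField.algebraMap_apply]
    ring
  | zero => exact ⟨0, zero_mem _, 0, zero_mem _, 0, zero_mem _, by simp⟩
  | add u v _ _ hu hv =>
    obtain ⟨c₁, h₁, c₂, h₂, y, hy, rfl⟩ := hu
    obtain ⟨d₁, k₁, d₂, k₂, y', hy', rfl⟩ := hv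
    exact ⟨_, add_mem h₁ k₁, _, add_mem h₂ k₂, _, add_mem hy hy', by ring⟩

include hL in
-- By maximality `-1` lies in the cone over `L(s)`; the coefficient of `s` in its expansion
-- vanishes, since otherwise one could solve for `s` in `L`.
theorem exists_add_mul_eq_neg_one {s : E} (ha : s ^ 2 ∈ L) (hs : s ∉ L) :
    ∃ c₁ ∈ T.cone L, ∃ c₂ ∈ T.cone L, c₁ + s ^ 2 * c₂ = -1 := by
  obtain ⟨c₁, h₁, c₂, h₂, y, hy, h⟩ :=
    exists_eq_of_mem_cone_adjoin_sqrt ha rfl (neg_one_mem_cone_adjoin hL hs)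
  refine ⟨c₁, h₁, c₂, h₂, ?_⟩
  rcases eq_or_ne y 0 with rfl | hy0
  · simp [h]
  · refine absurd ?_ hs
    have : s = (-1 - c₁ - s ^ 2 * c₂) / y := by
      rw [eq_div_iff hy0, h]; ring
    rw [this]
    exact div_mem (sub_mem (sub_mem (neg_mem (one_mem L)) (mem_of_mem_cone h₁))
      (mul_mem ha (mem_of_mem_cone h₂))) hy

include hL in
theorem mem_of_sq_mem_cone {s : E} (h : s ^ 2 ∈ T.cone L) : s ∈ L := by
  by_contra hs
  obtain ⟨c₁, h₁, c₂, h₂, h'⟩ := exists_add_mul_eq_neg_one hL (mem_of_mem_cone h) hs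
  exact hL.prop (h' ▸ add_mem h₁ (mul_mem_cone h h₂))

include hL in
theorem mem_cone_or_neg_mem_cone [IsAlgClosed E] {a : E} (ha : a ∈ L) :
    a ∈ T.cone L ∨ -a ∈ T.cone L := by
  obtain ⟨s, hs⟩ := IsAlgClosed.exists_pow_nat_eq (-a) (n := 2) two_pos
  by_cases hsL : s ∈ L
  · exact .inr (hs ▸ sq_mem_cone hsL)
  · left
    -- Here `c₁ - a c₂ = -1`, so `a = (1 + c₁) / c₂`, and dividing by `c₂` is multiplying by `c₂ ·
    -- c₂⁻²`.
    obtain ⟨c₁, h₁, c₂, h₂, h⟩ := exists_add_mul_eq_neg_one hL (hs ▸ neg_mem ha) hsL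
    rw [hs] at h
    have h0 : c₂ ≠ 0 := by
      rintro rfl
      exact hL.prop (by simpa [← h] using h₁)
    have : a = (1 + c₁) * c₂ * c₂⁻¹ ^ 2 := by
      field_simp
      linear_combination -h
    rw [this]
    exact mul_mem_cone (mul_mem_cone (add_mem (one_mem_cone L) h₁) h₂)
      (sq_mem_cone (L.inv_mem (mem_of_mem_cone h₂)))

variable (L) in
/-- The elements of `L` lying in the cone over `L`, when `-1` does not. -/
def ringCone (h : (-1 : E) ∉ T.cone L) : RingCone L where
  carrier := {x | (x : E) ∈ T.cone L}
  mul_mem' := mul_mem_cone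
  one_mem' := one_mem_cone L
  add_mem' ha hb := (T.cone L).add_mem ha hb
  zero_mem' := zero_mem (T.cone L)
  eq_zero_of_mem_of_neg_mem' {a} h₁ h₂ := by
    by_contra h0
    refine h ?_
    have ha : (a : E) ≠ 0 := fun h => h0 (Subtype.ext h)
    -- `a · (-a) · a⁻² = -1`.
    have := mul_mem_cone (mul_mem_cone h₁ h₂) (sq_mem_cone (T := T) (L.inv_mem a.2))
    convert this using 1
    push_cast
    field_simp

variable (T) in
/-- A preordered field maps to a real closed field, with nonnegative elements going to nonnegative
elements. -/
theorem exists_ringHom_isRealClosed :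
    ∃ (R : Type u) (_ : Field R) (_ : LinearOrder R) (_ : IsStrictOrderedRing R)
      (_ : IsRealClosed R) (φ : K →+* R), ∀ t ∈ T, 0 ≤ φ t := by
  classical
  obtain ⟨L, hL⟩ := exists_maximal_neg_one_notMem_cone (AlgebraicClosure K) T
  let C := ringCone L hL.prop
  let _ : LinearOrder L :=
    { PartialOrder.mkOfAddGroupCone C with
      le_total := fun a b => by
        rcases mem_cone_or_neg_mem_cone hL (b - a).2 with h | h
        · exact .inl h
        · exact .inr (by
            change ((a - b : L) : AlgebraicClosure K) ∈ T.cone L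
            convert h using 1
            push_cast
            ring)
      toDecidableLE := Classical.decRel _ }
  have : IsOrderedRing L := .mkOfCone C
  have : IsStrictOrderedRing L := IsOrderedRing.toIsStrictOrderedRing L
  have hnonneg : ∀ x : L, 0 ≤ x ↔ (x : AlgebraicClosure K) ∈ T.cone L := fun x => by
    change x - 0 ∈ C ↔ _
    rw [sub_zero]
    rfl
  have hsq : ∀ x : L, 0 ≤ x → IsSquare x := fun x hx => by
    obtain ⟨s, hs⟩ := IsAlgClosed.exists_pow_nat_eq (x : AlgebraicClosure K) (n := 2) two_pos
    refine ⟨⟨s, mem_of_sq_mem_cone hL (hs ▸ (hnonneg x).1 hx)⟩, Subtype.ext ?_⟩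
    simp [← hs, pow_two]
  refine ⟨L, inferInstance, inferInstance, inferInstance,
    .of_linearOrderedField (fun {x} => hsq x) (exists_isRoot_of_odd_natDegree_of_neg_one_mem
      (E := AlgebraicClosure K) fun θ hθ => ?_), algebraMap K L,
    fun t ht => (hnonneg _).2 (algebraMap_mem_cone ht)⟩
  have hθL : θ ∉ L := fun h => hθ ⟨⟨θ, h⟩, rfl⟩
  -- Elements of `T` are squares in `L`, so the cone over `L(θ)` consists of plain sums of squares.
  refine AddSubmonoid.closure_mono ?_ (neg_one_mem_cone_adjoin hL hθL)
  rintro z ⟨t, ht, x, hx, rfl⟩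
  obtain ⟨s, hs⟩ := hsq (algebraMap K L t) ((hnonneg _).2 (algebraMap_mem_cone ht))
  refine ⟨s * x, mul_mem ((L⟮θ⟯).algebraMap_mem s) hx, ?_⟩
  have : algebraMap K (AlgebraicClosure K) t = (s : AlgebraicClosure K) * s :=
    congrArg Subtype.val hs
  rw [this]
  ring

end RingPreordering

end RealClosure

/-! ### Orderings of a domain with support zero. -/

section PrimeCones

namespace RealSpectrum

variable {A : Type u} [CommRing A]

theorem mem_supp {α : RealSpectrum A} {a : A} : a ∈ α.supp ↔ a ∈ α.1 ∧ -a ∈ α.1 := Iff.rfl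

theorem mem_or_neg_mem (α : RealSpectrum A) (a : A) : a ∈ α.1 ∨ -a ∈ α.1 :=
  HasMemOrNegMem.mem_or_neg_mem α.1 a

/-- The preordering on the fraction field induced by a point of the real spectrum with support
zero. -/
def fractionPreordering [IsDomain A] (β : RealSpectrum A) (hβ : β.supp = ⊥) :
    RingPreordering (FractionRing A) :=
  .mk' {z | ∃ t ∈ β.1, ∃ b : A, b ≠ 0 ∧
      z = algebraMap A (FractionRing A) t / algebraMap A (FractionRing A) b ^ 2}
    (by
      rintro _ _ ⟨t, ht, b, hb, rfl⟩ ⟨s, hs, c, hc, rfl⟩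
      have hb' : algebraMap A (FractionRing A) b ≠ 0 := by simpa using hb
      have hc' : algebraMap A (FractionRing A) c ≠ 0 := by simpa using hc
      refine ⟨t * c ^ 2 + s * b ^ 2, add_mem (mul_mem ht (β.1.pow_two_mem c))
        (mul_mem hs (β.1.pow_two_mem b)), b * c, mul_ne_zero hb hc, ?_⟩
      simp only [map_add, map_mul, map_pow]
      field_simp)
    (by
      rintro _ _ ⟨t, ht, b, hb, rfl⟩ ⟨s, hs, c, hc, rfl⟩
      refine ⟨t * s, mul_mem ht hs, b * c, mul_ne_zero hb hc, ?_⟩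
      simp only [map_mul]
      ring)
    (fun z => by
      obtain ⟨a, b, hb, rfl⟩ := IsFractionRing.div_surjective (A := A) z
      refine ⟨a * a, β.1.mul_self_mem a, b, nonZeroDivisors.ne_zero hb, ?_⟩
      simp only [map_mul]
      ring)
    (by
      rintro ⟨t, ht, b, hb, h⟩
      have hb' : algebraMap A (FractionRing A) b ≠ 0 := by simpa using hb
      have ht' : t = -b ^ 2 := IsFractionRing.injective A (FractionRing A) (by
        rw [eq_div_iff (pow_ne_zero 2 hb')] at h
        rw [map_neg, map_pow, ← h]
        ring)
      have : b ^ 2 ∈ β.supp := mem_supp.2 ⟨β.1.pow_two_mem b, ht' ▸ ht⟩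
      rw [hβ, Ideal.mem_bot] at this
      exact hb (pow_eq_zero_iff two_ne_zero |>.1 this))

/-- An element which is nonnegative under all homomorphisms to real closed fields is nonnegative
at every point with support zero. -/
theorem mem_of_forall_ringHom_nonneg [IsDomain A] (β : RealSpectrum A) (hβ : β.supp = ⊥) {a : A}
    (h : ∀ (R : Type u) [Field R] [LinearOrder R] [IsStrictOrderedRing R] [IsRealClosed R]
      (φ : A →+* R), 0 ≤ φ a) : a ∈ β.1 := by
  rcases β.mem_or_neg_mem a with ha | ha
  · exact ha
  obtain ⟨R, _, _, _, _, φ, hφ⟩ := (fractionPreordering β hβ).exists_ringHom_isRealClosed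
  have h₁ := h R (φ.comp (algebraMap A (FractionRing A)))
  have h₂ := hφ (algebraMap A _ (-a)) ⟨-a, ha, 1, one_ne_zero, by simp⟩
  rw [map_neg, map_neg, neg_nonneg] at h₂
  -- Since `φ` is injective on the fraction field, `a = 0`.
  have h0 : φ (algebraMap A (FractionRing A) a) = 0 := le_antisymm h₂ h₁
  rw [map_eq_zero, FaithfulSMul.algebraMap_eq_zero_iff] at h0
  exact h0 ▸ zero_mem β.1

theorem mulVec_dotProduct_mem_of_isPsd [IsDomain A] (β : RealSpectrum A) (hβ : β.supp = ⊥) {n : ℕ}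
    {M : Matrix (Fin n) (Fin n) A} (hM : IsPsdOnRealSpectrum M) (v : Fin n → A) :
    dotProduct v (M.mulVec v) ∈ β.1 :=
  β.mem_of_forall_ringHom_nonneg hβ fun R _ _ _ _ φ => by
    have := hM R φ (φ ∘ v)
    have hφ : (M.map φ).mulVec (φ ∘ v) = φ ∘ M.mulVec v :=
      funext fun i => (φ.map_mulVec M v i).symm
    rwa [hφ, ← φ.map_dotProduct] at this

end RealSpectrum

/-! ### Orders at a prime and lifting of orderings. -/

theorem Prime.pow_mul_inj {A : Type*} [CommRing A] [IsDomain A] {p : A} (hp : Prime p) {k l : ℕ}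
    {b c : A} (hb : ¬ p ∣ b) (hc : ¬ p ∣ c) (h : p ^ k * b = p ^ l * c) : k = l ∧ b = c := by
  have aux : ∀ {k l : ℕ} {b c : A}, ¬ p ∣ b → p ^ k * b = p ^ l * c → l ≤ k := by
    intro k l b c hb h
    by_contra! hlt
    obtain ⟨j, rfl⟩ := Nat.exists_eq_add_of_lt hlt
    refine hb ⟨p ^ j * c, mul_left_cancel₀ (pow_ne_zero k hp.ne_zero) ?_⟩
    rw [h]
    ring
  obtain rfl : k = l := le_antisymm (aux hc h.symm) (aux hb h)
  exact ⟨rfl, mul_left_cancel₀ (pow_ne_zero k hp.ne_zero) h⟩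

theorem Prime.exists_eq_pow_mul {A : Type*} [CommRing A] [IsDomain A]
    [UniqueFactorizationMonoid A] {p : A} (hp : Prime p) {a : A} (ha : a ≠ 0) :
    ∃ k b, ¬ p ∣ b ∧ a = p ^ k * b := by
  obtain ⟨b, hb, hb'⟩ :=
    (FiniteMultiplicity.of_prime_left hp ha).exists_eq_pow_mul_and_not_dvd
  exact ⟨_, b, hb', hb⟩

namespace RealSpectrum

variable {A : Type u} [CommRing A] {α : RealSpectrum A} {p : A}

/-- If `b + c` were in the support, then `-b = c - (b + c)` would be nonnegative at `α`, putting `b`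
in the support. Thus adding leading parts of the same sign does not raise the order at `p`. -/
theorem not_dvd_add_of_mem (hα : α.supp = Ideal.span {p}) {b c : A} (hb : b ∈ α.1)
    (hc : c ∈ α.1) (hpb : ¬ p ∣ b) : ¬ p ∣ b + c := by
  rw [← Ideal.mem_span_singleton, ← hα] at hpb ⊢
  intro h
  refine hpb (mem_supp.2 ⟨hb, ?_⟩)
  have := add_mem hc (mem_supp.1 h).2
  convert this using 1
  ring

/-- The nonnegative elements of the ordering of `A` in which `p ^ k * b`, for `b` prime to `p`,
has the sign of `s ^ k * b` at `α`; here `α` has support `(p)` and `s = ±1`. -/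
def liftCone (α : RealSpectrum A) (p s : A) : Set A :=
  {a | a = 0 ∨ ∃ k b, ¬ p ∣ b ∧ a = p ^ k * b ∧ s ^ k * b ∈ α.1}

theorem dvd_unit_pow_mul_iff {s : A} (hs : s * s = 1) (k : ℕ) {b : A} :
    p ∣ s ^ k * b ↔ p ∣ b :=
  (IsUnit.of_mul_eq_one s hs).pow k |>.dvd_mul_left

theorem add_mem_liftCone (hα : α.supp = Ideal.span {p}) {s : A} (hs : s * s = 1) {x y : A}
    (hx : x ∈ liftCone α p s) (hy : y ∈ liftCone α p s) : x + y ∈ liftCone α p s := by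
  rcases hx with rfl | ⟨k, b, hb, rfl, hbα⟩
  · rwa [zero_add]
  rcases hy with rfl | ⟨l, c, hc, rfl, hcα⟩
  · rw [add_zero]; exact .inr ⟨k, b, hb, rfl, hbα⟩
  -- The term of lower order decides: after extracting `p ^ k`, the other one lies in `(p)`, which
  -- is the support of `α`.
  have aux : ∀ {k j : ℕ} {b c : A}, ¬ p ∣ b → s ^ k * b ∈ α.1 →
      p ^ k * b + p ^ (k + j + 1) * c ∈ liftCone α p s := by
    intro k j b c hb hbα
    have hmem : s ^ k * (p * (p ^ j * c)) ∈ α.supp := by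
      rw [hα, Ideal.mem_span_singleton]
      exact Dvd.intro _ (by ring : p * (s ^ k * (p ^ j * c)) = _)
    refine .inr ⟨k, b + p * (p ^ j * c), ?_, by ring, ?_⟩
    · rwa [dvd_add_left (dvd_mul_right _ _)]
    · rw [mul_add]
      exact add_mem hbα (mem_supp.1 hmem).1
  rcases lt_trichotomy k l with h | rfl | h
  · obtain ⟨j, rfl⟩ := Nat.exists_eq_add_of_lt h
    exact aux hb hbα
  · refine .inr ⟨k, b + c, ?_, by ring, ?_⟩
    · rw [← dvd_unit_pow_mul_iff hs k, mul_add]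
      exact not_dvd_add_of_mem hα hbα hcα (by rwa [dvd_unit_pow_mul_iff hs])
    · rw [mul_add]
      exact add_mem hbα hcα
  · obtain ⟨j, rfl⟩ := Nat.exists_eq_add_of_lt h
    rw [add_comm]
    exact aux hc hcα

variable [IsDomain A]

theorem pow_mul_mem_liftCone_iff (hp : Prime p) {s : A} {k : ℕ} {b : A} (hb : ¬ p ∣ b) :
    p ^ k * b ∈ liftCone α p s ↔ s ^ k * b ∈ α.1 := by
  refine ⟨?_, fun h => .inr ⟨k, b, hb, rfl, h⟩⟩
  rintro (h | ⟨l, c, hc, h, hcα⟩)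
  · rcases mul_eq_zero.1 h with h | rfl
    · exact absurd h (pow_ne_zero k hp.ne_zero)
    · exact absurd (dvd_zero p) hb
  · obtain ⟨rfl, rfl⟩ := hp.pow_mul_inj hb hc h
    exact hcα

variable [UniqueFactorizationMonoid A]

/-- The preordering with underlying set `liftCone α p s`. -/
def liftPreordering (hα : α.supp = Ideal.span {p}) (hp : Prime p) {s : A} (hs : s * s = 1) :
    RingPreordering A :=
  .mk' (liftCone α p s) (add_mem_liftCone hα hs)
    (by
      rintro _ _ (rfl | ⟨k, b, hb, rfl, hbα⟩) (rfl | ⟨l, c, hc, rfl, hcα⟩)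
      · exact .inl (mul_zero 0)
      · exact .inl (zero_mul _)
      · exact .inl (mul_zero _)
      · refine .inr ⟨k + l, b * c, hp.not_dvd_mul hb hc, by ring, ?_⟩
        have := mul_mem hbα hcα
        convert this using 1
        ring)
    (fun x => by
      rcases eq_or_ne x 0 with rfl | hx
      · exact .inl (mul_zero 0)
      obtain ⟨k, b, hb, rfl⟩ := hp.exists_eq_pow_mul hx
      refine .inr ⟨k + k, b * b, hp.not_dvd_mul hb hb, by ring, ?_⟩
      have := α.1.mul_self_mem (s ^ k * b)
      convert this using 1
      ring)
    (by
      have h1 : ¬ p ∣ -1 := fun h => hp.not_isUnit (isUnit_of_dvd_unit h isUnit_one.neg)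
      have := pow_mul_mem_liftCone_iff (α := α) hp (s := s) (k := 0) h1
      rw [pow_zero, one_mul, pow_zero, one_mul] at this
      rw [this]
      exact α.1.neg_one_notMem)

theorem mem_liftPreordering {hα : α.supp = Ideal.span {p}} {hp : Prime p} {s : A} {hs : s * s = 1}
    {a : A} : a ∈ liftPreordering hα hp hs ↔ a ∈ liftCone α p s := Iff.rfl

/-- A point with support `(p)` lifts to a point with support zero at which `p` has the sign
of `s = ±1`. -/
theorem exists_lift (hα : α.supp = Ideal.span {p}) (hp : Prime p) {s : A} (hs : s * s = 1) :
    ∃ β : RealSpectrum A, β.supp = ⊥ ∧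
      ∀ k b, ¬ p ∣ b → (p ^ k * b ∈ β.1 ↔ s ^ k * b ∈ α.1) := by
  have hmem : HasMemOrNegMem (liftPreordering hα hp hs) := ⟨fun a => by
    simp only [mem_liftPreordering]
    rcases eq_or_ne a 0 with rfl | ha
    · exact .inl (.inl rfl)
    obtain ⟨k, b, hb, rfl⟩ := hp.exists_eq_pow_mul ha
    rw [← mul_neg, pow_mul_mem_liftCone_iff hp hb, pow_mul_mem_liftCone_iff hp (by rwa [dvd_neg]),
      mul_neg]
    exact α.mem_or_neg_mem _⟩
  have hsupp : (liftPreordering hα hp hs).support = ⊥ := by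
    rw [eq_bot_iff]
    intro a ha
    obtain ⟨h₁, h₂⟩ := RingPreordering.mem_support.1 ha
    by_contra h0
    obtain ⟨k, b, hb, rfl⟩ := hp.exists_eq_pow_mul h0
    rw [mem_liftPreordering] at h₁ h₂
    rw [pow_mul_mem_liftCone_iff hp hb] at h₁
    rw [← mul_neg, pow_mul_mem_liftCone_iff hp (by rwa [dvd_neg]), mul_neg] at h₂
    have : s ^ k * b ∈ α.supp := mem_supp.2 ⟨h₁, h₂⟩
    rw [hα, Ideal.mem_span_singleton, dvd_unit_pow_mul_iff hs] at this
    exact hb this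
  refine ⟨⟨liftPreordering hα hp hs, .mk' _ fun {x y} h => ?_⟩, hsupp,
    fun k b hb => pow_mul_mem_liftCone_iff hp hb⟩
  rw [hsupp] at h ⊢
  simpa using h

/-- If `c` has odd order at `p` and `c * g` is nonnegative at all points with support zero, then
`p` divides `g`. -/
theorem dvd_of_odd_of_forall_mem (hα : α.supp = Ideal.span {p}) (hp : Prime p) {m : ℕ}
    (hm : Odd m) {u g : A} (hu : ¬ p ∣ u)
    (h : ∀ β : RealSpectrum A, β.supp = ⊥ → p ^ m * u * g ∈ β.1) : p ∣ g := by
  by_contra hg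
  have hug := hp.not_dvd_mul hu hg
  -- As `m` is odd, the two lifts make both `u * g` and `-(u * g)` nonnegative at `α`.
  obtain ⟨β, hβ, h₁⟩ := exists_lift hα hp (s := 1) (one_mul 1)
  obtain ⟨γ, hγ, h₂⟩ := exists_lift hα hp (s := -1) (by ring)
  have hb := h β hβ
  have hc := h γ hγ
  rw [mul_assoc, h₁ m _ hug, one_pow, one_mul] at hb
  rw [mul_assoc, h₂ m _ hug, hm.neg_one_pow, neg_one_mul] at hc
  have : u * g ∈ α.supp := mem_supp.2 ⟨hb, hc⟩
  rw [hα, Ideal.mem_span_singleton] at this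
  exact hug this

end RealSpectrum

/-! ### Values of the quadratic form of a diagonalized matrix. -/

open scoped Matrix in
/-- The quadratic form of a symmetric matrix equivalent to a diagonal matrix takes values
divisible by the `i`-th diagonal entry at two vectors whose polar value is twice that entry. -/
theorem Matrix.exists_quadratic_values_of_eq_mul_diagonal_mul {A : Type*} [CommRing A]
    {ι : Type*} [Fintype ι] [DecidableEq ι] {M P Q : Matrix ι ι A} {e : ι → A} (hM : M.IsSymm)
    (hP : IsUnit P.det) (hQ : IsUnit Q.det) (h : M = P * diagonal e * Q) (i : ι) :
    ∃ (x y : ι → A) (s t : A), x ⬝ᵥ M *ᵥ x = e i * s ∧ y ⬝ᵥ M *ᵥ y = e i * t ∧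
      (x + y) ⬝ᵥ M *ᵥ (x + y) = e i * (s + t + 2) := by
  have hdiag : diagonal e *ᵥ Pi.single i 1 = e i • Pi.single i (1 : A) := by
    ext j
    rcases eq_or_ne j i with rfl | hj <;> simp [mulVec_diagonal, *]
  -- `x` cancels `Q` on the right and `y` cancels `P` on the left, so `yᵀ M x = e i`; symmetry of
  -- `M` lets `M y` be computed from `Mᵀ` and so be divisible by `e i` as well.
  set x := Q⁻¹ *ᵥ Pi.single i (1 : A)
  set y := (P⁻¹)ᵀ *ᵥ Pi.single i (1 : A)
  have hx : M *ᵥ x = e i • P *ᵥ Pi.single i 1 := by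
    rw [h, mulVec_mulVec, mul_assoc, mul_nonsing_inv _ hQ, mul_one, ← mulVec_mulVec, hdiag,
      mulVec_smul]
  have hy : M *ᵥ y = e i • Qᵀ *ᵥ Pi.single i 1 := by
    rw [← hM.eq, h, transpose_mul, transpose_mul, diagonal_transpose, mulVec_mulVec, mul_assoc,
      mul_assoc, ← transpose_mul, nonsing_inv_mul _ hP, transpose_one, mul_one, ← mulVec_mulVec,
      hdiag, mulVec_smul]
  have hyx : y ⬝ᵥ M *ᵥ x = e i := by
    rw [hx, dotProduct_smul, dotProduct_comm, ← dotProduct_transpose_mulVec, transpose_transpose,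
      dotProduct_comm, mulVec_mulVec, nonsing_inv_mul _ hP]
    simp
  have hxy : x ⬝ᵥ M *ᵥ y = e i := by
    rw [hy, dotProduct_smul, dotProduct_transpose_mulVec, mulVec_mulVec, mul_nonsing_inv _ hQ]
    simp
  refine ⟨x, y, x ⬝ᵥ P *ᵥ Pi.single i 1, y ⬝ᵥ Qᵀ *ᵥ Pi.single i 1, ?_, ?_, ?_⟩
  · rw [hx, dotProduct_smul, smul_eq_mul]
  · rw [hy, dotProduct_smul, smul_eq_mul]
  · rw [mulVec_add, dotProduct_add, add_dotProduct, add_dotProduct, hyx, hxy, hx, hy,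
      dotProduct_smul, dotProduct_smul, smul_eq_mul, smul_eq_mul]
    ring

end PrimeCones

/-! ### Parity of exponents and nonnegative associates. -/

section SmithNormalForm

variable {A : Type u} [CommRing A] [IsDomain A] [UniqueFactorizationMonoid A]

/-- A prime which is the support of a point of the real spectrum occurs to an even power in each
diagonal entry of a Smith normal form of a positive semidefinite matrix. -/
theorem even_of_supp_eq_of_isPsd {n : ℕ} {M P Q : Matrix (Fin n) (Fin n) A} {e : Fin n → A}
    (hM : M.IsSymm) (hpsd : IsPsdOnRealSpectrum M) (hP : IsUnit P.det) (hQ : IsUnit Q.det)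
    (h : M = P * Matrix.diagonal e * Q) (i : Fin n) {p : A} (hp : Prime p) {α : RealSpectrum A}
    (hα : α.supp = Ideal.span {p}) {m : ℕ} {u : A} (hu : ¬ p ∣ u) (hi : e i = p ^ m * u) :
    Even m := by
  by_contra hm
  rw [Nat.not_even_iff_odd] at hm
  obtain ⟨x, y, s, t, hx, hy, hxy⟩ :=
    Matrix.exists_quadratic_values_of_eq_mul_diagonal_mul hM hP hQ h i
  have key : ∀ (v : Fin n → A) (g : A), dotProduct v (M.mulVec v) = e i * g → p ∣ g :=
    fun v g hg => RealSpectrum.dvd_of_odd_of_forall_mem hα hp hm hu fun β hβ => by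
      rw [← hi, ← hg]
      exact β.mulVec_dotProduct_mem_of_isPsd hβ hpsd v
  -- `p` divides `s`, `t` and `s + t + 2`. Then `-2` is nonnegative at `α`, and so is `-1 = 1 +
  -- (-2)`.
  have h2 : p ∣ 2 :=
    (dvd_add_right (dvd_add (key x s hx) (key y t hy))).1 (key (x + y) _ hxy)
  rw [← Ideal.mem_span_singleton, ← hα, RealSpectrum.mem_supp] at h2
  refine α.1.neg_one_notMem ?_
  have := add_mem (one_mem α.1) h2.2
  convert this using 1
  ring

/-- Work one prime power at a time: an even power is a square, a prime without sign change is
nonnegative up to sign, and a non-real prime has a positive associate by (PNRI). -/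
theorem exists_associated_nonneg (hPNRI : PNRI A) (d : A)
    (hd : ∀ p : A, IsRealIrreducible p → ChangesSign p → ∀ (m : ℕ) (u : A), ¬ p ∣ u →
      d = p ^ m * u → Even m) :
    ∃ d' : A, Associated d d' ∧ ∀ α : RealSpectrum A, α.IsNonneg d' := by
  induction d using UniqueFactorizationMonoid.induction_on_coprime with
  | h0 => exact ⟨0, .refl 0, fun α => zero_mem α.1⟩
  | h1 hx => exact ⟨1, associated_one_iff_isUnit.2 hx, fun α => one_mem α.1⟩
  | hpr i hp =>
    rename_i p
    by_cases hreal : IsSemireal (A ⧸ Ideal.span {p})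
    · by_cases hs : ChangesSign p
      · have := hd p ⟨hp.irreducible, hreal⟩ hs i 1 (fun h => hp.not_isUnit (isUnit_of_dvd_one h))
          (mul_one _).symm
        exact ⟨p ^ i, .refl _, fun α => α.1.mem_of_isSquare (this.isSquare_pow p)⟩
      · have hor : (∀ α : RealSpectrum A, p ∈ α.1) ∨ ∀ α : RealSpectrum A, -p ∈ α.1 := by
          by_contra! hcon
          obtain ⟨⟨α, hα⟩, β, hβ⟩ := hcon
          exact hs ⟨β, α, ⟨(β.mem_or_neg_mem p).resolve_right hβ, fun h => hβ h.2⟩,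
            (α.mem_or_neg_mem p).resolve_left hα, fun h => hα (by simpa using h.2)⟩
        rcases hor with h | h
        · exact ⟨p ^ i, .refl _, fun α => pow_mem (h α) i⟩
        · exact ⟨(-p) ^ i, (Associated.refl p).neg_right.pow_pow, fun α => pow_mem (h α) i⟩
    · obtain ⟨q, hpq, -, hq⟩ := hPNRI p ⟨hp.irreducible, hreal⟩
      exact ⟨q ^ i, hpq.pow_pow, fun α => pow_mem (hq α).1 i⟩
  | hcp hxy hx hy =>
    rename_i x y
    -- A prime dividing `x` does not divide `y`, so its order in `x` equals its order in `x * y`.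
    have aux : ∀ {x y : A}, IsRelPrime x y →
        (∀ p : A, IsRealIrreducible p → ChangesSign p → ∀ (m : ℕ) (u : A), ¬ p ∣ u →
          x * y = p ^ m * u → Even m) →
        ∀ p : A, IsRealIrreducible p → ChangesSign p → ∀ (m : ℕ) (u : A), ¬ p ∣ u →
          x = p ^ m * u → Even m := by
      intro x y hxy h p hp hps m u hu hx
      rcases Nat.eq_zero_or_pos m with rfl | hm
      · exact Even.zero
      have hpx : p ∣ x := hx ▸ (dvd_pow_self p hm.ne').mul_right u
      have hpy : ¬ p ∣ y := fun hpy => hp.1.not_isUnit (hxy hpx hpy)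
      exact h p hp hps m (u * y) (hp.1.prime.not_dvd_mul hu hpy) (by rw [hx, mul_assoc])
    obtain ⟨x', hx', hx''⟩ := hx (aux hxy hd)
    obtain ⟨y', hy', hy''⟩ := hy (aux hxy.symm (by simpa only [mul_comm y x] using hd))
    exact ⟨x' * y', hx'.mul_mul hy', fun α => mul_mem (hx'' α) (hy'' α)⟩

end SmithNormalForm

theorem mainTheorem1 {A : Type u} [CommRing A] [IsDomain A] [UniqueFactorizationMonoid A]
    [IsRegularRing A] {n : ℕ} (M : Matrix (Fin n) (Fin n) A) (hM : M.IsSymm)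
    (hpsd : IsPsdOnRealSpectrum M) {r : ℕ} (hr : r ≤ n) (d : Fin r → A)
    (hdvd : ∀ i j : Fin r, i ≤ j → d i ∣ d j) (hsmith : MatrixEquivalent M (diagZero n d))
    (hPNRI : PNRI A)
    (hGRI : ∀ p : A, IsRealIrreducible p → (∃ k, p ∣ d k) → ChangesSign p → GRI p) :
    ∀ k : Fin r, ∃ d' : A, Associated (d k) d' ∧ ∀ α : RealSpectrum A,
      α.IsNonneg d' ∧ (d k ∉ α.supp → α.IsPos d') := by
  intro k
  obtain ⟨P, Q, hP, hQ, h⟩ := hsmith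
  obtain ⟨d', hd', hnonneg⟩ := exists_associated_nonneg hPNRI (d k) fun p hp hps m u hu hm => by
    rcases Nat.eq_zero_or_pos m with rfl | hm0
    · exact Even.zero
    obtain ⟨α, -, hα, -, -⟩ := hGRI p hp ⟨k, hm ▸ (dvd_pow_self p hm0.ne').mul_right u⟩ hps
    exact even_of_supp_eq_of_isPsd hM hpsd hP hQ h ⟨k, k.2.trans_le hr⟩ hp.1.prime hα hu
      (by simpa using hm)
  refine ⟨d', hd', fun α => ⟨hnonneg α, fun hk => ⟨hnonneg α, fun h' => hk ?_⟩⟩⟩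
  -- Associates lie in the same ideals, so off the support of `α` nonnegative becomes positive.
  exact α.supp.mem_of_dvd hd'.symm.dvd h'
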